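/- Let $k$ be a field of characteristic zero and $R=k[x_1,\dots,x_r]$. Let $A=R/I$ be a graded artinian quotient of $R$, where $I$ is a homogeneous ideal containing no non-zero form of degree $1$. Its $h$-vector is $h=(h_0,\dots,h_e)$, where $h_i=\dim_k A_i$ and $e$ (the socle degree) is the last index with $h_e>0$; thus $h_0=1$, and if $e\ge 1$ then $h_1=r$. The socle of $A$ is $\operatorname{soc}(A)=\{u\in A : u\bar x_1=\dots=u\bar x_r=0\}$, and $A$ is level of type $t$ if $\operatorname{soc}(A)_i=0$ for $i<e$ and $\dim_k\operatorname{soc}(A)_e=t$ (so that $h_e=t$). A level $h$-vector of type $2$ and codimension $r$ is the $h$-vector of such an algebra $A$ that is level of type $2$. (i) If $h=(1,r,\dots,a,2)$ is a level $h$-vector of type $2$ and codimension $r$, with socle degree $e\ge 2$ and $a=h_{e-1}$, then $a\le 2r$. Moreover, for all integers $r\ge 2$, $e\ge 3$ and $a\in[r,2r]$ with $(r,e,a)\ne(2,3,4)$, there is a level $h$-vector $h=(1,r,\dots,a,2)$ over $k$ of type $2$, codimension $r$ and socle degree $e$ with $h_{e-1}=a$. (The triple $(2,3,4)$ has to be left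 out, since $h_2\le 3$ when $r=2$.) (ii) If $h=(1,r,\dots,a,2)$ is a level $h$-vector of type $2$ and codimension $r$, with socle degree $e\ge 2$ and $a=h_{e-1}$, and if $r\le 7$, then $a\ge r$. -/

import Mathlib

open MvPolynomial

namespace LevelAlgebra

noncomputable section

attribute [local instance] MvPolynomial.gradedAlgebra

/-- The degree `i` component `A_i` of `A = k[x_1, ..., x_r] / I`: the image of the space of forms of
degree `i`. -/
def component {k : Type*} [Field k] {r : ℕ} (I : Ideal (MvPolynomial (Fin r) k)) (i : ℕ) :
    Submodule k (MvPolynomial (Fin r) k ⧸ I) :=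
  (homogeneousSubmodule (Fin r) k i).map (Ideal.Quotient.mkₐ k I).toLinearMap

/-- The Hilbert function `i ↦ dim_k A_i` of `A = k[x_1, ..., x_r] / I`. -/
def hVector {k : Type*} [Field k] {r : ℕ} (I : Ideal (MvPolynomial (Fin r) k)) (i : ℕ) : ℕ :=
  Module.finrank k (component I i)

/-- The socle of `A = k[x_1, ..., x_r] / I`: the annihilator of the ideal of `A` generated by the
classes of the variables. -/
def socle {k : Type*} [Field k] {r : ℕ} (I : Ideal (MvPolynomial (Fin r) k)) :
    Ideal (MvPolynomial (Fin r) k ⧸ I) :=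
  Submodule.annihilator
    (Ideal.span (Set.range fun j : Fin r => Ideal.Quotient.mk I (X j)))

/-- The socle-vector of `A = k[x_1, ..., x_r] / I`: `i ↦ dim_k soc(A)_i`. -/
def socleVector {k : Type*} [Field k] {r : ℕ} (I : Ideal (MvPolynomial (Fin r) k)) (i : ℕ) : ℕ :=
  Module.finrank k ↥((socle I).restrictScalars k ⊓ component I i)

/-- `A = k[x_1, ..., x_r] / I` is a standard graded artinian level algebra of codimension `r`,
socle degree `e` and type `t`. -/
structure IsLevelAlgebra {k : Type*} [Field k] {r : ℕ} (I : Ideal (MvPolynomial (Fin r) k))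
    (e t : ℕ) : Prop where
  homogeneous : I.IsHomogeneous (homogeneousSubmodule (Fin r) k)
  artinian : IsArtinianRing (MvPolynomial (Fin r) k ⧸ I)
  no_linear_form : ∀ f ∈ I, f.IsHomogeneous 1 → f = 0
  socle_degree : IsGreatest {i | 0 < hVector I i} e
  socle_below : ∀ i < e, socleVector I i = 0
  socle_top : socleVector I e = t

/-- `h` (extended by zero beyond degree `e`) is the `h`-vector of a level algebra over `k` of
codimension `r`, socle degree `e` and type `t`. -/
def IsLevelHVector (k : Type*) [Field k] (r e t : ℕ) (h : ℕ → ℕ) : Prop :=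
  ∃ I : Ideal (MvPolynomial (Fin r) k), IsLevelAlgebra I e t ∧ hVector I = h

end

end LevelAlgebra

/-! Upper bound: below the socle degree an element is determined by its products with linear forms,
so `A_{e-1}` embeds in `Hom(A_1, A_e)`, of dimension `2r`; see `LevelPieces.finrank_le_mul`.

Lower bound: let `p, q` be functionals that separate the points of `A_e`. Let `K_p ⊆ A_1` and `S_p ⊆
A_{e-1}` be the left and right kernels of the pairing `p (x * y)`. If `a < r`, then `dim S_p < dim
K_p`. The annihilator of `K_p` in `A_1` has codimension at least 2 (`finrank_annIn_add_two_le`) and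
at most `dim S_p` (`finrank_le_finrank_annIn_add`), so `dim K_p ≥ 3`. The same holds for `q` and `p
+ q`. But `K_p` is annihilated by both `K_q` and `K_{p+q}`, which are disjoint, so its annihilator
has dimension at least 6, whence `r ≥ 8`.

Existence: Macaulay duality attaches a level algebra of type 2 to a pencil of dual forms, here `∑
x_i^e` and `x_0^e + ∑_{i<J} x_i^{e-1} x_{i+1}` with `J = a - r`. Contracting by the variables
produces the span of `r` pure powers and `J` mixed monomials, so `h_{e-1} = r + J`. -/

namespace LevelAlgebra

/-! ### Kernels of pairings and the numerical bounds -/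

section Pairing

variable {k A : Type*} [Field k] [CommRing A] [Algebra k A]

/-- The elements of `V` that pair to zero with all of `W` under `(x, y) ↦ p (x * y)`. -/
def perp (p : A →ₗ[k] k) (V W : Submodule k A) : Submodule k A where
  carrier := {x | x ∈ V ∧ ∀ y ∈ W, p (x * y) = 0}
  add_mem' := fun ha hb => ⟨V.add_mem ha.1 hb.1, fun y hy => by
    rw [add_mul, map_add, ha.2 y hy, hb.2 y hy, add_zero]⟩
  zero_mem' := ⟨V.zero_mem, fun y _ => by simp⟩
  smul_mem' := fun c x hx => ⟨V.smul_mem c hx.1, fun y hy => by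
    rw [smul_mul_assoc, map_smul, hx.2 y hy, smul_zero]⟩

theorem mem_perp {p : A →ₗ[k] k} {V W : Submodule k A} {x : A} :
    x ∈ perp p V W ↔ x ∈ V ∧ ∀ y ∈ W, p (x * y) = 0 := Iff.rfl

theorem perp_le (p : A →ₗ[k] k) (V W : Submodule k A) : perp p V W ≤ V := fun _ h => h.1

/-- Rank-nullity for `V → W*`: its kernel is the left kernel, and its image annihilates the right
kernel. -/
theorem finrank_add_finrank_perp_le (p : A →ₗ[k] k) (V W : Submodule k A)
    [FiniteDimensional k V] [FiniteDimensional k W] :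
    Module.finrank k V + Module.finrank k (perp p W V) ≤
      Module.finrank k W + Module.finrank k (perp p V W) := by
  let B : V →ₗ[k] Module.Dual k W :=
    LinearMap.mk₂ k (fun x y => p ((x : A) * y)) (fun x x' y => by simp [add_mul])
      (fun c x y => by simp) (fun x y y' => by simp [mul_add]) (fun c x y => by simp)
  have hker : Module.finrank k (LinearMap.ker B) ≤ Module.finrank k (perp p V W) := by
    have hle : (LinearMap.ker B).map V.subtype ≤ perp p V W := by
      rintro _ ⟨x, hx, rfl⟩
      exact ⟨x.2, fun y hy => DFunLike.congr_fun (LinearMap.mem_ker.1 hx) (⟨y, hy⟩ : W)⟩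
    rw [LinearEquiv.finrank_eq (Submodule.equivMapOfInjective V.subtype V.injective_subtype
      (LinearMap.ker B))]
    have := Submodule.finiteDimensional_of_le (perp_le p V W)
    exact Submodule.finrank_mono hle
  let W' : Submodule k W := (perp p W V).comap W.subtype
  have hW' : Module.finrank k W' = Module.finrank k (perp p W V) :=
    (Submodule.comapSubtypeEquivOfLe (perp_le p W V)).finrank_eq
  have hrange : Module.finrank k (LinearMap.range B) ≤ Module.finrank k W'.dualAnnihilator := by
    refine Submodule.finrank_mono ?_
    rintro _ ⟨x, rfl⟩
    rw [Submodule.mem_dualAnnihilator]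
    intro y hy
    change p ((x : A) * y) = 0
    rw [mul_comm]
    exact (mem_perp.1 hy).2 x x.2
  have h1 := Subspace.finrank_add_finrank_dualAnnihilator_eq W'
  have h2 := LinearMap.finrank_range_add_finrank_ker B
  omega

/-- The graded pieces `C i` of a level algebra of socle degree `e`. -/
structure LevelPieces (C : ℕ → Submodule k A) (e : ℕ) : Prop where
  finite : ∀ i, FiniteDimensional k (C i)
  one_mem : (1 : A) ∈ C 0
  mul_mem : ∀ {i j : ℕ} {x y : A}, x ∈ C i → y ∈ C j → x * y ∈ C (i + j)
  eq_zero : ∀ {i : ℕ} {u : A}, i < e → u ∈ C i → (∀ l ∈ C 1, u * l = 0) → u = 0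

namespace LevelPieces

variable {C : ℕ → Submodule k A} {e : ℕ}

theorem pow_mem (hC : LevelPieces C e) {z : A} (hz : z ∈ C 1) (i : ℕ) : z ^ i ∈ C i := by
  induction i with
  | zero => simpa using hC.one_mem
  | succ i ih => rw [pow_succ]; exact hC.mul_mem ih hz

/-- Iterating the socle condition one degree at a time: vanishing can be tested in the socle degree.
-/
theorem eq_zero_of_mul_eq_zero (hC : LevelPieces C e) {i j : ℕ} (hij : i + j = e) {u : A}
    (hu : u ∈ C i) (h : ∀ t ∈ C j, u * t = 0) : u = 0 := by
  induction j generalizing i u with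
  | zero => simpa using h 1 hC.one_mem
  | succ j ih =>
    refine hC.eq_zero (by omega) hu fun l hl => ?_
    refine ih (i := i + 1) (by omega) (hC.mul_mem hu hl) fun t ht => ?_
    rw [mul_assoc]
    exact h _ (by simpa [add_comm] using hC.mul_mem hl ht)

theorem finrank_le_mul (hC : LevelPieces C (e + 1)) :
    Module.finrank k (C e) ≤ Module.finrank k (C 1) * Module.finrank k (C (e + 1)) := by
  have := hC.finite
  let B : C e →ₗ[k] C 1 →ₗ[k] C (e + 1) :=
    LinearMap.mk₂ k (fun x y => ⟨(x : A) * y, hC.mul_mem x.2 y.2⟩)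
      (fun x x' y => by ext; simp [add_mul])
      (fun c x y => by ext; simp) (fun x y y' => by ext; simp [mul_add])
      (fun c x y => by ext; simp)
  rw [← Module.finrank_linearMap k k]
  refine LinearMap.finrank_le_finrank_of_injective (f := B) ?_
  rw [injective_iff_map_eq_zero]
  intro x hx
  refine Subtype.ext (hC.eq_zero (Nat.lt_succ_self e) x.2 fun l hl => ?_)
  exact congrArg Subtype.val (DFunLike.congr_fun hx (⟨l, hl⟩ : C 1))

/-- Two functionals separate the points of `C e`. -/
def Separates (C : ℕ → Submodule k A) (e : ℕ) (p q : A →ₗ[k] k) : Prop :=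
  ∀ x ∈ C e, p x = 0 → q x = 0 → x = 0

theorem Separates.symm {p q : A →ₗ[k] k} (h : Separates C e p q) : Separates C e q p :=
  fun x hx hq hp => h x hx hp hq

theorem Separates.add_right {p q : A →ₗ[k] k} (h : Separates C e p q) :
    Separates C e p (p + q) :=
  fun x hx hp hpq => h x hx hp (by simpa [hp] using hpq)

theorem Separates.add_left {p q : A →ₗ[k] k} (h : Separates C e p q) :
    Separates C e q (p + q) :=
  fun x hx hq hpq => h x hx (by simpa [hq] using hpq) hq

theorem exists_separates (h : Module.finrank k (C e) = 2) :
    ∃ p q : A →ₗ[k] k, Separates C e p q := by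
  have : FiniteDimensional k (C e) := FiniteDimensional.of_finrank_pos (by omega)
  let b := Module.finBasisOfFinrankEq k (C e) h
  obtain ⟨p, hp⟩ := (b.coord 0).exists_extend
  obtain ⟨q, hq⟩ := (b.coord 1).exists_extend
  refine ⟨p, q, fun x hx hpx hqx => ?_⟩
  have h0 : b.coord 0 ⟨x, hx⟩ = 0 := by rw [← hp]; exact hpx
  have h1 : b.coord 1 ⟨x, hx⟩ = 0 := by rw [← hq]; exact hqx
  have : (⟨x, hx⟩ : C e) = 0 := by
    refine b.ext_elem fun i => ?_
    fin_cases i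
    · simpa using h0
    · simpa using h1
  exact congrArg Subtype.val this

section Kernels

variable {p q : A →ₗ[k] k}

/-- For `t` of complementary degree, `p` kills `l * m * t` because of `l`, and `q` kills it because
of `m`. -/
theorem mul_eq_zero_of_mem_perp (hC : LevelPieces C (e + 2))
    (hpq : Separates C (e + 2) p q) {l m : A}
    (hl : l ∈ perp p (C 1) (C (e + 1))) (hm : m ∈ perp q (C 1) (C (e + 1))) : l * m = 0 := by
  refine hC.eq_zero_of_mul_eq_zero (i := 2) (j := e) (by omega) (hC.mul_mem hl.1 hm.1)
    fun t ht => ?_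
  have hmul : ∀ x ∈ C 1, x * t ∈ C (e + 1) := fun x hx => by
    simpa [add_comm] using hC.mul_mem hx ht
  refine hpq _ ?_ ?_ ?_
  · simpa [add_comm] using hC.mul_mem (hC.mul_mem hl.1 hm.1) ht
  · rw [mul_assoc]; exact hl.2 _ (hmul m hm.1)
  · rw [mul_comm l m, mul_assoc]; exact hm.2 _ (hmul l hl.1)

theorem disjoint_perp (hC : LevelPieces C (e + 2)) (hpq : Separates C (e + 2) p q) :
    Disjoint (perp p (C 1) (C (e + 1))) (perp q (C 1) (C (e + 1))) := by
  rw [Submodule.disjoint_def]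
  intro l hp hq
  refine hC.eq_zero_of_mul_eq_zero (j := e + 1) (by omega) hp.1 fun s hs => ?_
  exact hpq _ (add_comm 1 (e + 1) ▸ hC.mul_mem hp.1 hs) (hp.2 s hs) (hq.2 s hs)

theorem mul_mem_perp (hC : LevelPieces C (e + 2))
    {m t : A} (hm : m ∈ perp p (C 1) (C (e + 1))) (ht : t ∈ C e) :
    m * t ∈ perp p (C (e + 1)) (C 1) := by
  refine ⟨by simpa [add_comm] using hC.mul_mem hm.1 ht, fun l hl => ?_⟩
  rw [mul_assoc]
  exact hm.2 _ (hC.mul_mem ht hl)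

/-- The elements of `V` annihilating `K`. -/
def annIn (V K : Submodule k A) : Submodule k A where
  carrier := {x | x ∈ V ∧ ∀ y ∈ K, x * y = 0}
  add_mem' := fun ha hb => ⟨V.add_mem ha.1 hb.1, fun y hy => by
    rw [add_mul, ha.2 y hy, hb.2 y hy, add_zero]⟩
  zero_mem' := ⟨V.zero_mem, fun y _ => by simp⟩
  smul_mem' := fun c x hx => ⟨V.smul_mem c hx.1, fun y hy => by
    rw [smul_mul_assoc, hx.2 y hy, smul_zero]⟩

/-- Membership in the annihilator of `K_p` needs only orthogonality to `S_p` under `q`: for `m ∈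
K_p`, `p` already kills `l * m * t`, and `m * t` lies in `S_p`. This imposes at most `dim S_p`
conditions. -/
theorem finrank_le_finrank_annIn_add (hC : LevelPieces C (e + 2)) (hpq : Separates C (e + 2) p q) :
    Module.finrank k (C 1) ≤ Module.finrank k (annIn (C 1) (perp p (C 1) (C (e + 1)))) +
      Module.finrank k (perp p (C (e + 1)) (C 1)) := by
  have := hC.finite
  have := Submodule.finiteDimensional_of_le (perp_le p (C (e + 1)) (C 1))
  have hle : perp q (C 1) (perp p (C (e + 1)) (C 1)) ≤
      annIn (C 1) (perp p (C 1) (C (e + 1))) := by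
    refine fun l hl => ⟨hl.1, fun m hm => ?_⟩
    refine hC.eq_zero_of_mul_eq_zero (i := 2) (j := e) (by omega) (hC.mul_mem hl.1 hm.1)
      fun t ht => ?_
    have hlt : l * t ∈ C (e + 1) := by simpa [add_comm] using hC.mul_mem hl.1 ht
    refine hpq _ ?_ ?_ ?_
    · simpa [add_comm] using hC.mul_mem (hC.mul_mem hl.1 hm.1) ht
    · rw [mul_comm l m, mul_assoc]; exact hm.2 _ hlt
    · rw [mul_assoc]; exact hl.2 _ (hC.mul_mem_perp hm ht)
  have h1 := finrank_add_finrank_perp_le q (C 1) (perp p (C (e + 1)) (C 1))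
  have : FiniteDimensional k (annIn (C 1) (perp p (C 1) (C (e + 1)))) :=
    Submodule.finiteDimensional_of_le (S₂ := C 1) fun _ h => h.1
  have h2 := Submodule.finrank_mono hle
  omega

/-- Modulo the annihilator of `K` the only linear form is `z`, so on `m * z ^ j` the socle condition
involves multiplication by `z` alone. -/
theorem eq_zero_of_mul_pow_eq_zero (hC : LevelPieces C (e + 2))
    {K : Submodule k A} {z : A} (hz : z ∈ C 1)
    (hspan : C 1 ≤ annIn (C 1) K ⊔ Submodule.span k {z}) {m : A} (hm1 : m ∈ C 1) (hm : m ∈ K)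
    {j : ℕ} (hj : j ≤ e + 1) (h : m * z ^ j = 0) : m = 0 := by
  induction j with
  | zero => simpa using h
  | succ j ih =>
    refine ih (by omega) ?_
    refine hC.eq_zero (i := 1 + j) (by omega) (hC.mul_mem hm1 (hC.pow_mem hz j)) fun l hl => ?_
    obtain ⟨x, hx, y, hy, rfl⟩ := Submodule.mem_sup.1 (hspan hl)
    obtain ⟨c, rfl⟩ := Submodule.mem_span_singleton.1 hy
    have h1 : m * z ^ j * x = 0 := by
      rw [mul_right_comm, mul_comm m, hx.2 m hm, zero_mul]
    rw [mul_add, h1, mul_smul_comm, mul_assoc, ← pow_succ, h, smul_zero, add_zero]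

theorem finrank_annIn_add_two_le (hC : LevelPieces C (e + 2)) (hpq : Separates C (e + 2) p q)
    (hlt : Module.finrank k (perp p (C (e + 1)) (C 1)) <
      Module.finrank k (perp p (C 1) (C (e + 1)))) :
    Module.finrank k (annIn (C 1) (perp p (C 1) (C (e + 1)))) + 2 ≤ Module.finrank k (C 1) := by
  have := hC.finite
  set K := perp p (C 1) (C (e + 1)) with hK
  have hKle : K ≤ C 1 := perp_le _ _ _
  have hann : annIn (C 1) K ≤ C 1 := fun _ h => h.1
  have := Submodule.finiteDimensional_of_le hann
  have := Submodule.finiteDimensional_of_le hKle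
  by_contra hcon
  -- If the codimension is at most 1, a single `z` (possibly 0) completes the annihilator to `C 1`.
  obtain ⟨z, hz, hspan⟩ : ∃ z ∈ C 1, C 1 ≤ annIn (C 1) K ⊔ Submodule.span k {z} := by
    by_cases hCle : C 1 ≤ annIn (C 1) K
    · exact ⟨0, zero_mem _, hCle.trans le_sup_left⟩
    · obtain ⟨z, hz, hz'⟩ := SetLike.not_le_iff_exists.1 hCle
      refine ⟨z, hz, le_of_eq (Submodule.eq_of_le_of_finrank_le ?_ ?_).symm⟩
      · exact sup_le hann (by simpa [Submodule.span_le] using hz)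
      · have : annIn (C 1) K < annIn (C 1) K ⊔ Submodule.span k {z} :=
          lt_of_le_of_ne le_sup_left fun h => hz' (by
            rw [h]; exact Submodule.mem_sup_right (Submodule.mem_span_singleton_self z))
        have := Submodule.finrank_lt_finrank_of_lt this
        omega
  have hzpow : z ^ (e + 1) ∈ C (e + 1) := hC.pow_mem hz _
  have hK1 : Module.finrank k K ≤ 1 := by
    -- `p` vanishes on `m * z ^ (e + 1)` for `m ∈ K`, so `q` alone detects it.
    let f : K →ₗ[k] k := q ∘ₗ LinearMap.mulRight k (z ^ (e + 1)) ∘ₗ K.subtype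
    rw [← Module.finrank_self k]
    refine LinearMap.finrank_le_finrank_of_injective (f := f) ?_
    rw [injective_iff_map_eq_zero]
    rintro ⟨m, hm⟩ hfm
    refine Subtype.ext (hC.eq_zero_of_mul_pow_eq_zero hz hspan hm.1 hm le_rfl ?_)
    exact hpq _ (add_comm 1 (e + 1) ▸ hC.mul_mem hm.1 hzpow) (hm.2 _ hzpow) hfm
  have := Submodule.finiteDimensional_of_le (perp_le p (C (e + 1)) (C 1))
  have hS : perp p (C (e + 1)) (C 1) = ⊥ := Submodule.finrank_eq_zero.1 (by omega)
  -- Products of `K` with `C e` land in `S_p = 0`, so `K` is killed by all linear forms.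
  have hK0 : K = ⊥ := by
    rw [Submodule.eq_bot_iff]
    refine fun m hm => hC.eq_zero (i := 1) (by omega) hm.1 fun l hl => ?_
    refine hC.eq_zero_of_mul_eq_zero (i := 2) (j := e) (by omega) (hC.mul_mem hm.1 hl)
      fun t ht => ?_
    have := hC.mul_mem_perp hm ht
    rw [hS, Submodule.mem_bot] at this
    rw [mul_right_comm, this, zero_mul]
  rw [hK0, finrank_bot] at hlt
  omega

theorem finrank_le_of_finrank_le_seven (hC : LevelPieces C (e + 2))
    (h2 : Module.finrank k (C (e + 2)) = 2)
    (h7 : Module.finrank k (C 1) ≤ 7) :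
    Module.finrank k (C 1) ≤ Module.finrank k (C (e + 1)) := by
  have := hC.finite
  by_contra hcon
  obtain ⟨p, q, hpq⟩ := exists_separates h2
  have hlt : ∀ p : A →ₗ[k] k, Module.finrank k (perp p (C (e + 1)) (C 1)) <
      Module.finrank k (perp p (C 1) (C (e + 1))) := fun p => by
    have := finrank_add_finrank_perp_le p (C 1) (C (e + 1))
    omega
  have three_le : ∀ p q : A →ₗ[k] k, Separates C (e + 2) p q →
      3 ≤ Module.finrank k (perp p (C 1) (C (e + 1))) := fun p q h => by
    have h1 := hC.finrank_annIn_add_two_le h (hlt p)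
    have h2 := hC.finrank_le_finrank_annIn_add h
    have h3 := hlt p
    omega
  have hq := three_le q p hpq.symm
  have hpq' := three_le (p + q) p hpq.add_right.symm
  have hdisj := hC.disjoint_perp hpq.add_left
  have := Submodule.finiteDimensional_of_le (perp_le q (C 1) (C (e + 1)))
  have := Submodule.finiteDimensional_of_le (perp_le (p + q) (C 1) (C (e + 1)))
  have : FiniteDimensional k (annIn (C 1) (perp p (C 1) (C (e + 1)))) :=
    Submodule.finiteDimensional_of_le (S₂ := C 1) fun _ h => h.1
  have hsup : perp q (C 1) (C (e + 1)) ⊔ perp (p + q) (C 1) (C (e + 1)) ≤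
      annIn (C 1) (perp p (C 1) (C (e + 1))) :=
    sup_le (fun l hl => ⟨hl.1, fun m hm => hC.mul_eq_zero_of_mem_perp hpq.symm hl hm⟩)
      (fun l hl => ⟨hl.1, fun m hm => hC.mul_eq_zero_of_mem_perp hpq.add_right.symm hl hm⟩)
  have h1 := Submodule.finrank_mono hsup
  have h3 := Submodule.finrank_sup_add_finrank_inf_eq (perp q (C 1) (C (e + 1)))
    (perp (p + q) (C 1) (C (e + 1)))
  rw [hdisj.eq_bot, finrank_bot] at h3
  have h4 := hC.finrank_annIn_add_two_le hpq (hlt p)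
  -- `3 + 3 ≤ dim Ann K_p ≤ r - 2 ≤ 5` is absurd.
  omega

end Kernels

end LevelPieces

end Pairing

end LevelAlgebra

namespace LevelAlgebra

/-! ### Graded components of the quotient -/

section Component

variable {k : Type*} [Field k] {r : ℕ} {I : Ideal (MvPolynomial (Fin r) k)}

theorem mk_mem_component {i : ℕ} {f : MvPolynomial (Fin r) k} (hf : f.IsHomogeneous i) :
    Ideal.Quotient.mk I f ∈ component I i := ⟨f, hf, rfl⟩

theorem finiteDimensional_homogeneousSubmodule (k : Type*) [Field k] (r i : ℕ) :
    FiniteDimensional k (homogeneousSubmodule (Fin r) k i) :=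
  Module.Finite.of_fg (homogeneousSubmodule_fg (Fin r) k i)

theorem finiteDimensional_component (I : Ideal (MvPolynomial (Fin r) k)) (i : ℕ) :
    FiniteDimensional k (component I i) :=
  Module.Finite.of_fg ((homogeneousSubmodule_fg (Fin r) k i).map _)

theorem mem_socle {u : MvPolynomial (Fin r) k ⧸ I} :
    u ∈ socle I ↔ ∀ j, u * Ideal.Quotient.mk I (X j) = 0 := by
  rw [socle, Ideal.span, Submodule.mem_annihilator_span]
  simp

theorem socleVector_eq_zero_iff {i : ℕ} :
    socleVector I i = 0 ↔ ∀ u ∈ component I i, u ∈ socle I → u = 0 := by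
  have := finiteDimensional_component I i
  have := Submodule.finiteDimensional_of_le
    (inf_le_right : (socle I).restrictScalars k ⊓ component I i ≤ component I i)
  rw [socleVector, Submodule.finrank_eq_zero, Submodule.eq_bot_iff]
  exact ⟨fun h u hu hs => h u ⟨hs, hu⟩, fun h u hu => h u hu.2 hu.1⟩

theorem hVector_eq_zero_iff {i : ℕ} :
    hVector I i = 0 ↔ ∀ f : MvPolynomial (Fin r) k, f.IsHomogeneous i → f ∈ I := by
  have := finiteDimensional_component I i
  rw [hVector, Submodule.finrank_eq_zero, Submodule.eq_bot_iff]
  refine ⟨fun h f hf => Ideal.Quotient.eq_zero_iff_mem.1 (h _ (mk_mem_component hf)), ?_⟩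
  rintro h _ ⟨f, hf, rfl⟩
  exact Ideal.Quotient.eq_zero_iff_mem.2 (h f hf)

/-- The Hilbert function in degree `i` is the rank of any linear map that is surjective on forms of
degree `i` and cuts out `I` there. -/
theorem hVector_eq_finrank {i : ℕ} {W : Type*} [AddCommGroup W] [Module k W]
    (Ψ : MvPolynomial (Fin r) k →ₗ[k] W)
    (hker : ∀ f : MvPolynomial (Fin r) k, f.IsHomogeneous i → (f ∈ I ↔ Ψ f = 0))
    (hsurj : ∀ w, ∃ f : MvPolynomial (Fin r) k, f.IsHomogeneous i ∧ Ψ f = w) :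
    hVector I i = Module.finrank k W := by
  have := finiteDimensional_homogeneousSubmodule k r i
  let π : homogeneousSubmodule (Fin r) k i →ₗ[k] MvPolynomial (Fin r) k ⧸ I :=
    (Ideal.Quotient.mkₐ k I).toLinearMap.domRestrict _
  let ψ : homogeneousSubmodule (Fin r) k i →ₗ[k] W := Ψ.domRestrict _
  have hk : LinearMap.ker π = LinearMap.ker ψ := by
    ext f
    exact Ideal.Quotient.eq_zero_iff_mem.trans (hker f f.2)
  have hψ : LinearMap.range ψ = ⊤ := by
    rw [LinearMap.range_eq_top]
    intro w
    obtain ⟨f, hf, rfl⟩ := hsurj w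
    exact ⟨⟨f, hf⟩, rfl⟩
  have hπ : LinearMap.range π = component I i := LinearMap.range_domRestrict _ _
  have h1 := LinearMap.finrank_range_add_finrank_ker π
  have h2 := LinearMap.finrank_range_add_finrank_ker ψ
  rw [hπ, hk] at h1
  rw [hψ, finrank_top] at h2
  rw [hVector]
  omega

theorem eq_zero_of_isHomogeneous_one {f : MvPolynomial (Fin r) k} (hf : f.IsHomogeneous 1)
    (h : ∀ j, coeff (Finsupp.single j 1) f = 0) : f = 0 := by
  ext d
  rw [coeff_zero]
  by_contra hd
  have hd' : d ∈ Set.range fun j : Fin r => Finsupp.single j 1 := by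
    rw [Finsupp.range_single_one]
    exact by_contra fun h => hd (hf.coeff_eq_zero h)
  obtain ⟨j, rfl⟩ := hd'
  exact hd (h j)

theorem hVector_one (h : ∀ f ∈ I, f.IsHomogeneous 1 → f = 0) : hVector I 1 = r := by
  have := hVector_eq_finrank (I := I) (i := 1)
    (LinearMap.pi fun j : Fin r => lcoeff k (Finsupp.single j 1)) (fun f hf => ?_) (fun w => ?_)
  · simpa using this
  · refine ⟨fun hfI => by rw [h f hfI hf, map_zero], fun h0 => ?_⟩
    rw [eq_zero_of_isHomogeneous_one hf fun j => congrFun h0 j]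
    exact zero_mem I
  · refine ⟨∑ j, w j • X j, ?_, ?_⟩
    · exact Submodule.sum_mem (homogeneousSubmodule (Fin r) k 1) fun j _ =>
        Submodule.smul_mem _ _ (isHomogeneous_X k j)
    · ext j
      simp [coeff_X, Finsupp.single_left_inj]

theorem hVector_zero (h : I ≠ ⊤) : hVector I 0 = 1 := by
  have := hVector_eq_finrank (I := I) (i := 0) (lcoeff k 0) (fun f hf => ?_) (fun w => ?_)
  · simpa using this
  · obtain ⟨c, rfl⟩ : ∃ c, f = C c :=
      ⟨_, totalDegree_eq_zero_iff_eq_C.1 ((totalDegree_zero_iff_isHomogeneous _).2 hf)⟩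
    constructor
    · intro hc
      by_contra hne
      refine h (Ideal.eq_top_of_isUnit_mem _ hc ?_)
      exact (isUnit_iff_ne_zero.2 (by simpa using hne)).map C
    · intro hc
      have : c = 0 := by simpa using hc
      simp [this]
  · exact ⟨C w, isHomogeneous_C _ w, by simp⟩

variable {e t : ℕ}

theorem IsLevelAlgebra.hVector_one (h : IsLevelAlgebra I e t) : hVector I 1 = r :=
  LevelAlgebra.hVector_one h.no_linear_form

/-- Multiplication by a variable lands in a zero component, so all of degree `e` is socle. -/
theorem hVector_eq_socleVector (h : hVector I (e + 1) = 0) : hVector I e = socleVector I e := by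
  have hle : component I e ≤ (socle I).restrictScalars k := by
    rintro _ ⟨f, hf, rfl⟩
    refine mem_socle.2 fun j => ?_
    exact Ideal.Quotient.eq_zero_iff_mem.2
      (hVector_eq_zero_iff.1 h (f * X j) (hf.mul (isHomogeneous_X k j)))
  rw [hVector, socleVector, inf_eq_right.2 hle]

theorem IsLevelAlgebra.hVector_socleDegree (h : IsLevelAlgebra I e t) : hVector I e = t := by
  rw [← h.socle_top]
  refine hVector_eq_socleVector (Nat.eq_zero_of_not_pos fun hpos => ?_)
  have : e + 1 ≤ e := h.socle_degree.2 hpos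
  omega

theorem IsLevelAlgebra.levelPieces (h : IsLevelAlgebra I e t) : LevelPieces (component I) e where
  finite := finiteDimensional_component I
  one_mem := mk_mem_component (isHomogeneous_one _ _)
  mul_mem := by
    rintro i j _ _ ⟨f, hf, rfl⟩ ⟨g, hg, rfl⟩
    exact ⟨f * g, hf.mul hg, by simp⟩
  eq_zero := fun hi hu hl => socleVector_eq_zero_iff.1 (h.socle_below _ hi) _ hu
    (mem_socle.2 fun j => hl _ (mk_mem_component (isHomogeneous_X k j)))

theorem IsLevelAlgebra.hVector_le (h : IsLevelAlgebra I (e + 1) t) : hVector I e ≤ r * t := by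
  have := h.levelPieces.finrank_le_mul
  rwa [← hVector, ← hVector, ← hVector, h.hVector_one, h.hVector_socleDegree] at this

theorem IsLevelAlgebra.le_hVector (h : IsLevelAlgebra I (e + 2) 2) (hr : r ≤ 7) :
    r ≤ hVector I (e + 1) := by
  have := h.levelPieces.finrank_le_of_finrank_le_seven h.hVector_socleDegree
    (h.hVector_one.trans_le hr)
  rwa [← hVector, ← hVector, h.hVector_one] at this

end Component

end LevelAlgebra

namespace LevelAlgebra

/-! ### Level algebras from inverse systems -/

section Apolar

attribute [local instance] MvPolynomial.gradedAlgebra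

variable {k : Type*} [Field k] {r : ℕ} {T : Type*} [AddCommGroup T] [Module k T]

/-- The largest ideal contained in the kernel of a linear map on the polynomial ring. -/
def apolarIdeal (Φ : MvPolynomial (Fin r) k →ₗ[k] T) : Ideal (MvPolynomial (Fin r) k) where
  carrier := {f | ∀ g, Φ (f * g) = 0}
  add_mem' := fun ha hb g => by rw [add_mul, map_add, ha g, hb g, add_zero]
  zero_mem' := fun g => by simp
  smul_mem' := fun c f hf g => by
    rw [smul_eq_mul, mul_comm c f, mul_assoc]
    exact hf _

/-- A linear map on the polynomial ring that vanishes on forms of degree different from `e`. -/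
def IsConcentrated (Φ : MvPolynomial (Fin r) k →ₗ[k] T) (e : ℕ) : Prop :=
  ∀ ⦃n : ℕ⦄ ⦃f : MvPolynomial (Fin r) k⦄, f.IsHomogeneous n → n ≠ e → Φ f = 0

variable {Φ : MvPolynomial (Fin r) k →ₗ[k] T} {e : ℕ}

theorem IsConcentrated.apply_eq (hΦ : IsConcentrated Φ e) (f : MvPolynomial (Fin r) k) :
    Φ f = Φ (homogeneousComponent e f) := by
  conv_lhs => rw [← sum_homogeneousComponent f, map_sum]
  refine Finset.sum_eq_single e
    (fun n _ hn => hΦ (homogeneousComponent_isHomogeneous n f) hn) fun he => ?_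
  rw [homogeneousComponent_eq_zero _ _ (by simpa using he), map_zero]

theorem IsConcentrated.comp_mulLeft (hΦ : IsConcentrated Φ e) {i j : ℕ} (hij : i + j = e)
    {f : MvPolynomial (Fin r) k} (hf : f.IsHomogeneous i) :
    IsConcentrated (Φ ∘ₗ LinearMap.mulLeft k f) j :=
  fun _ _ hg hn => hΦ (hf.mul hg) (by omega)

theorem IsConcentrated.mem_apolarIdeal_iff (hΦ : IsConcentrated Φ e) {i j : ℕ} (hij : i + j = e)
    {f : MvPolynomial (Fin r) k} (hf : f.IsHomogeneous i) :
    f ∈ apolarIdeal Φ ↔ ∀ g : MvPolynomial (Fin r) k, g.IsHomogeneous j → Φ (f * g) = 0 :=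
  ⟨fun h g _ => h g, fun h g => ((hΦ.comp_mulLeft hij hf).apply_eq g).trans
    (h _ (homogeneousComponent_isHomogeneous j g))⟩

theorem IsConcentrated.mem_apolarIdeal_of_lt (hΦ : IsConcentrated Φ e) {i : ℕ} (hi : e < i)
    {f : MvPolynomial (Fin r) k} (hf : f.IsHomogeneous i) : f ∈ apolarIdeal Φ := by
  intro g
  rw [← sum_homogeneousComponent g, Finset.mul_sum, map_sum]
  exact Finset.sum_eq_zero fun n _ =>
    hΦ (hf.mul (homogeneousComponent_isHomogeneous n g)) (by omega)

/-- Against a form of degree `e - i`, only the degree `i` component of `f` contributes. -/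
theorem IsConcentrated.isHomogeneous_apolarIdeal (hΦ : IsConcentrated Φ e) :
    (apolarIdeal Φ).IsHomogeneous (homogeneousSubmodule (Fin r) k) := by
  intro i f hf
  have hcomp : (DirectSum.decompose (homogeneousSubmodule (Fin r) k) f i :
      MvPolynomial (Fin r) k) = homogeneousComponent i f := decomposition.decompose'_apply f i
  rw [hcomp]
  have hfi := homogeneousComponent_isHomogeneous i f
  rcases lt_or_ge e i with hi | hi
  · exact hΦ.mem_apolarIdeal_of_lt hi hfi
  · obtain ⟨j, rfl⟩ := Nat.exists_eq_add_of_le hi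
    refine (hΦ.mem_apolarIdeal_iff rfl hfi).2 fun g hg => ?_
    have := (hΦ.comp_mulLeft (add_comm j i) hg).apply_eq f
    simp only [LinearMap.comp_apply, LinearMap.mulLeft_apply] at this
    rw [mul_comm, ← this, mul_comm]
    exact hf g

theorem IsConcentrated.isArtinianRing (hΦ : IsConcentrated Φ e) :
    IsArtinianRing (MvPolynomial (Fin r) k ⧸ apolarIdeal Φ) := by
  have htop : (⊤ : Submodule k (MvPolynomial (Fin r) k ⧸ apolarIdeal Φ)) =
      ⨆ i : Fin (e + 1), component (apolarIdeal Φ) i := by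
    refine (eq_top_iff.2 fun u _ => ?_).symm
    obtain ⟨f, rfl⟩ := Ideal.Quotient.mk_surjective u
    rw [← sum_homogeneousComponent f, map_sum]
    refine Submodule.sum_mem _ fun n _ => ?_
    have hn := homogeneousComponent_isHomogeneous n f
    rcases lt_or_ge e n with h | h
    · rw [Ideal.Quotient.eq_zero_iff_mem.2 (hΦ.mem_apolarIdeal_of_lt h hn)]
      exact zero_mem _
    · exact Submodule.mem_iSup_of_mem (⟨n, by omega⟩ : Fin (e + 1)) (mk_mem_component hn)
  have : Module.Finite k (MvPolynomial (Fin r) k ⧸ apolarIdeal Φ) := by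
    refine ⟨?_⟩
    rw [htop]
    exact Submodule.fg_iSup _ fun i => (homogeneousSubmodule_fg (Fin r) k i).map _
  exact IsArtinianRing.of_finite k _

theorem IsConcentrated.hVector_top (hΦ : IsConcentrated Φ e) (hsurj : Function.Surjective Φ) :
    hVector (apolarIdeal Φ) e = Module.finrank k T := by
  refine hVector_eq_finrank Φ (fun f hf => ⟨fun h => by simpa using h 1, fun h => ?_⟩) fun w => ?_
  · refine (hΦ.mem_apolarIdeal_iff (add_zero e) hf).2 fun g hg => ?_
    rw [totalDegree_eq_zero_iff_eq_C.1 ((totalDegree_zero_iff_isHomogeneous _).2 hg), mul_comm,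
      C_mul', map_smul, h, smul_zero]
  · obtain ⟨f, rfl⟩ := hsurj w
    exact ⟨_, homogeneousComponent_isHomogeneous e f, (hΦ.apply_eq f).symm⟩

theorem mem_span_X_of_isHomogeneous {n : ℕ} (hn : n ≠ 0) {g : MvPolynomial (Fin r) k}
    (hg : g.IsHomogeneous n) : g ∈ Ideal.span (Set.range (X : Fin r → MvPolynomial (Fin r) k)) := by
  rw [← Set.image_univ, mem_ideal_span_X_image]
  intro m hm
  by_contra hcon
  have hm0 : m = 0 := by
    ext i
    by_contra hi
    exact hcon ⟨i, trivial, hi⟩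
  have := hg (mem_support_iff.1 hm)
  rw [hm0, map_zero] at this
  exact hn this.symm

/-- The test forms for degree `i` have positive degree, hence lie in the ideal of the variables,
which a socle element kills. -/
theorem IsConcentrated.socleVector_eq_zero (hΦ : IsConcentrated Φ e) {i : ℕ} (hi : i < e) :
    socleVector (apolarIdeal Φ) i = 0 := by
  rw [socleVector_eq_zero_iff]
  rintro _ ⟨f, hf, rfl⟩ hs
  refine Ideal.Quotient.eq_zero_iff_mem.2 ?_
  obtain ⟨j, rfl⟩ := Nat.exists_eq_add_of_lt hi
  refine (hΦ.mem_apolarIdeal_iff (add_assoc i j 1).symm hf).2 fun g hg => ?_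
  have hfX : ∀ l, f * X l ∈ apolarIdeal Φ := fun l =>
    Ideal.Quotient.eq_zero_iff_mem.1 (mem_socle.1 hs l)
  have hfg : f * g ∈ apolarIdeal Φ := by
    have hg' := mem_span_X_of_isHomogeneous (by omega) hg
    clear hg
    induction hg' using Submodule.span_induction with
    | mem x hx => obtain ⟨l, rfl⟩ := hx; exact hfX l
    | zero => simp
    | add x y _ _ hx hy => rw [mul_add]; exact add_mem hx hy
    | smul a x _ hx => rw [smul_eq_mul, mul_left_comm]; exact Ideal.mul_mem_left _ _ hx
  simpa using hfg 1

theorem IsConcentrated.isLevelAlgebra (hΦ : IsConcentrated Φ e) (hsurj : Function.Surjective Φ)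
    (hT : 0 < Module.finrank k T)
    (hlin : ∀ f ∈ apolarIdeal Φ, f.IsHomogeneous 1 → f = 0) :
    IsLevelAlgebra (apolarIdeal Φ) e (Module.finrank k T) where
  homogeneous := hΦ.isHomogeneous_apolarIdeal
  artinian := hΦ.isArtinianRing
  no_linear_form := hlin
  socle_degree := by
    refine ⟨(hT.trans_eq (hΦ.hVector_top hsurj).symm : 0 < hVector _ _), fun i hi => ?_⟩
    by_contra hcon
    refine (ne_of_gt (show 0 < hVector _ _ from hi)) (hVector_eq_zero_iff.2 fun f hf => ?_)
    exact hΦ.mem_apolarIdeal_of_lt (not_le.1 hcon) hf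
  socle_below := fun i hi => hΦ.socleVector_eq_zero hi
  socle_top := by
    rw [← hVector_eq_socleVector, hΦ.hVector_top hsurj]
    exact hVector_eq_zero_iff.2 fun f hf => hΦ.mem_apolarIdeal_of_lt (Nat.lt_succ_self e) hf

end Apolar

/-! ### The pencil realizing each value of `a` -/

section Construction

variable {k : Type*} [Field k] {n : ℕ}

/-- The exponent of `x_i ^ d * x_{i+1}`, indices taken cyclically. -/
noncomputable def cyclicExponent (d : ℕ) (i : Fin (n + 2)) : Fin (n + 2) →₀ ℕ :=
  Finsupp.single i d + Finsupp.single (i + 1) 1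

/-- The sum of the coefficients of all `x_i ^ e`. -/
noncomputable def powerForm (k : Type*) [Field k] (n e : ℕ) :
    MvPolynomial (Fin (n + 2)) k →ₗ[k] k :=
  ∑ i, lcoeff k (Finsupp.single i e)

/-- The coefficient of `x_0 ^ e` plus those of `x_i ^ (e - 1) * x_{i+1}` for `i < J`, for
`e = d + 1`. -/
noncomputable def chainForm (k : Type*) [Field k] (n d J : ℕ) :
    MvPolynomial (Fin (n + 2)) k →ₗ[k] k :=
  lcoeff k (Finsupp.single 0 (d + 1)) +
    ∑ i : {i : Fin (n + 2) // (i : ℕ) < J}, lcoeff k (cyclicExponent d i.1)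

/-- The two forms of degree `d + 1` that generate the inverse system of the example. -/
noncomputable def pencil (k : Type*) [Field k] (n d J : ℕ) :
    MvPolynomial (Fin (n + 2)) k →ₗ[k] k × k :=
  (powerForm k n (d + 1)).prod (chainForm k n d J)

theorem powerForm_apply (e : ℕ) (f : MvPolynomial (Fin (n + 2)) k) :
    powerForm k n e f = ∑ i, coeff (Finsupp.single i e) f := by
  simp [powerForm]

theorem chainForm_apply (d J : ℕ) (f : MvPolynomial (Fin (n + 2)) k) :
    chainForm k n d J f = coeff (Finsupp.single 0 (d + 1)) f +
      ∑ i : {i : Fin (n + 2) // (i : ℕ) < J}, coeff (cyclicExponent d i.1) f := by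
  simp [chainForm]

theorem cyclicExponent_apply_self (d : ℕ) (i : Fin (n + 2)) : cyclicExponent d i i = d := by
  simp [cyclicExponent]

theorem cyclicExponent_apply_succ (d : ℕ) (i : Fin (n + 2)) : cyclicExponent d i (i + 1) = 1 := by
  simp [cyclicExponent]

theorem cyclicExponent_apply_of_ne (d : ℕ) {i j : Fin (n + 2)} (h : j ≠ i) (h' : j ≠ i + 1) :
    cyclicExponent d i j = 0 := by
  simp [cyclicExponent, h.symm, h'.symm]

theorem degree_cyclicExponent (d : ℕ) (i : Fin (n + 2)) :
    (cyclicExponent d i).degree = d + 1 := by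
  simp [cyclicExponent]

theorem isConcentrated_pencil (d J : ℕ) : IsConcentrated (pencil k n d J) (d + 1) := by
  intro m f hf hm
  have h1 : powerForm k n (d + 1) f = 0 := by
    rw [powerForm_apply]
    exact Finset.sum_eq_zero fun i _ => hf.coeff_eq_zero (by simpa using hm.symm)
  have h2 : chainForm k n d J f = 0 := by
    rw [chainForm_apply, hf.coeff_eq_zero (by simpa using hm.symm), zero_add]
    exact Finset.sum_eq_zero fun i _ =>
      hf.coeff_eq_zero (by rw [degree_cyclicExponent]; exact hm.symm)
  exact Prod.ext h1 h2

theorem single_ne_cyclicExponent {d : ℕ} (hd : d ≠ 0) (i j : Fin (n + 2)) (c : ℕ) :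
    Finsupp.single i c ≠ cyclicExponent d j := by
  intro h
  have h1 := DFunLike.congr_fun h j
  have h2 := DFunLike.congr_fun h (j + 1)
  rw [cyclicExponent_apply_self, Finsupp.single_apply] at h1
  rw [cyclicExponent_apply_succ, Finsupp.single_apply] at h2
  have h3 : i = j := by by_contra hij; rw [if_neg hij] at h1; exact hd h1.symm
  have h4 : i = j + 1 := by by_contra hij; rw [if_neg hij] at h2; omega
  rw [h3] at h4
  simp at h4

theorem surjective_pencil {d : ℕ} (hd : d ≠ 0) (J : ℕ) :
    Function.Surjective (pencil k n d J) := by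
  -- The `x_0 ^ (d + 1)` term keeps the two forms independent even when `J = 0`.
  have h0 : pencil k n d J (monomial (Finsupp.single 0 (d + 1)) 1) = (1, 1) := by
    refine Prod.ext ?_ ?_
    · change powerForm k n (d + 1) _ = 1
      simp [powerForm_apply, coeff_monomial, Finsupp.single_left_inj, -Finsupp.single_add]
    · change chainForm k n d J _ = 1
      simp [chainForm_apply, coeff_monomial, single_ne_cyclicExponent hd, -Finsupp.single_add]
  have h1 : pencil k n d J (monomial (Finsupp.single 1 (d + 1)) 1) = (1, 0) := by
    refine Prod.ext ?_ ?_
    · change powerForm k n (d + 1) _ = 1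
      simp [powerForm_apply, coeff_monomial, Finsupp.single_left_inj, -Finsupp.single_add]
    · change chainForm k n d J _ = 0
      simp [chainForm_apply, coeff_monomial, single_ne_cyclicExponent hd, Finsupp.single_left_inj,
        -Finsupp.single_add]
  rintro ⟨a, b⟩
  refine ⟨b • monomial (Finsupp.single 0 (d + 1)) 1 +
    (a - b) • monomial (Finsupp.single 1 (d + 1)) 1, ?_⟩
  rw [map_add, map_smul, map_smul, h0, h1]
  simp

theorem powerForm_X_mul (e : ℕ) (j : Fin (n + 2)) (f : MvPolynomial (Fin (n + 2)) k) :
    powerForm k n (e + 1) (X j * f) = coeff (Finsupp.single j e) f := by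
  rw [powerForm_apply, Finset.sum_eq_single j]
  · rw [coeff_X_mul', if_pos (by simp)]
    congr 1
    ext i
    by_cases h : j = i <;> simp [h]
  · intro i _ hij
    rw [coeff_X_mul', if_neg (by simp [hij])]
  · simp

/-- Contracting the chain by `x_j` gives pure powers, which `hf` makes irrelevant, and the mixed
monomial starting at `x_j` when `j < J`. -/
theorem chainForm_X_mul (d J : ℕ) (j : Fin (n + 2)) (f : MvPolynomial (Fin (n + 2)) k)
    (hf : ∀ i, coeff (Finsupp.single i (d + 1)) f = 0) :
    chainForm k n (d + 1) J (X j * f) =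
      if (j : ℕ) < J then coeff (cyclicExponent d j) f else 0 := by
  have hpure : coeff (Finsupp.single 0 (d + 1 + 1)) (X j * f) = 0 := by
    rw [coeff_X_mul']
    split_ifs with h
    · have hj : 0 = j := by
        by_contra h0
        simp [h0] at h
      rw [← hj, ← Finsupp.single_tsub]
      exact hf 0
    · rfl
  have hother : ∀ i : Fin (n + 2), i ≠ j → coeff (cyclicExponent (d + 1) i) (X j * f) = 0 := by
    intro i hij
    rw [coeff_X_mul']
    split_ifs with h
    · have hj : j = i + 1 := by
        by_contra hj
        exact Finsupp.mem_support_iff.1 h (cyclicExponent_apply_of_ne _ hij.symm hj)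
      rw [cyclicExponent, hj, add_tsub_cancel_right]
      exact hf i
    · rfl
  have hself : coeff (cyclicExponent (d + 1) j) (X j * f) = coeff (cyclicExponent d j) f := by
    rw [coeff_X_mul', if_pos (by simp [cyclicExponent_apply_self])]
    congr 1
    rw [cyclicExponent, cyclicExponent, Finsupp.single_add, add_right_comm, add_tsub_cancel_right]
  rw [chainForm_apply, hpure, zero_add]
  split_ifs with hJ
  · rw [Finset.sum_eq_single ⟨j, hJ⟩ _ (by simp), hself]
    exact fun i _ hi => hother i fun h => hi (Subtype.ext h)
  · exact Finset.sum_eq_zero fun i _ => hother i fun h => hJ (h ▸ i.2)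

theorem eq_zero_of_mem_apolarIdeal_pencil (d J : ℕ) (f : MvPolynomial (Fin (n + 2)) k)
    (hf : f ∈ apolarIdeal (pencil k n (d + 1) J)) (hf1 : f.IsHomogeneous 1) : f = 0 := by
  refine eq_zero_of_isHomogeneous_one hf1 fun j => ?_
  have h := congrArg Prod.fst (hf (X j * X j ^ d))
  change powerForm k n (d + 1 + 1) (f * (X j * X j ^ d)) = 0 at h
  rwa [mul_left_comm, powerForm_X_mul, X_pow_eq_monomial, Finsupp.single_add,
    add_comm (Finsupp.single j d), coeff_mul_monomial, mul_one] at h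

/-- A coincidence forces `i = j + 1` and `j = i + 1`, hence two variables and the quadric `x_0 x_1`
listed twice: exactly the excluded triple. -/
theorem cyclicExponent_injOn {d J : ℕ} (hJ : J ≤ n + 2) (h : ¬(n = 0 ∧ d = 0 ∧ J = 2))
    {i j : Fin (n + 2)} (hi : (i : ℕ) < J) (hj : (j : ℕ) < J)
    (hij : cyclicExponent (d + 1) i = cyclicExponent (d + 1) j) : i = j := by
  by_contra hne
  have h1 := DFunLike.congr_fun hij i
  have h2 := DFunLike.congr_fun hij j
  rw [cyclicExponent_apply_self] at h1 h2
  have hi' : i = j + 1 := by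
    by_contra hcon
    rw [cyclicExponent_apply_of_ne _ hne hcon] at h1
    omega
  have hj' : j = i + 1 := by
    by_contra hcon
    rw [cyclicExponent_apply_of_ne _ (Ne.symm hne) hcon] at h2
    omega
  have hd : d = 0 := by
    rw [hi', cyclicExponent_apply_succ] at h1
    omega
  have h11 : (1 + 1 : Fin (n + 2)) = 0 := by
    rw [hi', add_assoc] at hj'
    simpa using hj'.symm
  have hn : n = 0 := by
    by_contra hn
    have := congrArg Fin.val h11
    rw [Fin.val_add, Fin.val_one, Nat.mod_eq_of_lt (by omega)] at this
    simp at this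
  subst hn
  have : J < 2 := by omega
  exact hne (Fin.ext (by omega))

/-- The monomials whose coefficients cut out the ideal of the pencil one degree below the top. -/
noncomputable def exponents (n d J : ℕ) :
    Fin (n + 2) ⊕ {i : Fin (n + 2) // (i : ℕ) < J} → (Fin (n + 2) →₀ ℕ) :=
  Sum.elim (fun i => Finsupp.single i (d + 1)) fun i => cyclicExponent d i.1

theorem degree_exponents (n d J : ℕ) (s : Fin (n + 2) ⊕ {i : Fin (n + 2) // (i : ℕ) < J}) :
    (exponents n d J s).degree = d + 1 := by
  rcases s with i | i
  · simp [exponents]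
  · simp [exponents, degree_cyclicExponent]

theorem exponents_injective {d J : ℕ} (hJ : J ≤ n + 2) (h : ¬(n = 0 ∧ d = 0 ∧ J = 2)) :
    Function.Injective (exponents n (d + 1) J) := by
  rintro (i | i) (j | j) hij
  · exact congrArg Sum.inl (Finsupp.single_left_injective (by omega) hij)
  · exact absurd hij (single_ne_cyclicExponent (by omega) _ _ _)
  · exact absurd hij.symm (single_ne_cyclicExponent (by omega) _ _ _)
  · exact congrArg Sum.inr (Subtype.ext (cyclicExponent_injOn hJ h i.2 j.2 hij))

theorem exists_isHomogeneous_coeff_eq {ι σ : Type*} [Fintype ι] {m : ι → σ →₀ ℕ} {d : ℕ}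
    (hm : Function.Injective m) (hd : ∀ i, (m i).degree = d) (w : ι → k) :
    ∃ f : MvPolynomial σ k, f.IsHomogeneous d ∧ ∀ i, coeff (m i) f = w i := by
  classical
  refine ⟨∑ i, monomial (m i) (w i), ?_, fun i => ?_⟩
  · exact IsHomogeneous.sum _ _ _ fun i _ => isHomogeneous_monomial _ (hd i)
  · simp [coeff_sum, coeff_monomial, hm.eq_iff]

/-- One degree below the top it suffices to test against variables. The power sum yields the pure
coefficients; once these vanish, the chain yields the mixed ones. -/
theorem mem_apolarIdeal_pencil_iff (d J : ℕ) {f : MvPolynomial (Fin (n + 2)) k}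
    (hf : f.IsHomogeneous (d + 1)) :
    f ∈ apolarIdeal (pencil k n (d + 1) J) ↔ ∀ s, coeff (exponents n d J s) f = 0 := by
  rw [(isConcentrated_pencil (d + 1) J).mem_apolarIdeal_iff rfl hf]
  constructor
  · intro h
    have hX : ∀ j, pencil k n (d + 1) J (X j * f) = 0 := fun j => by
      rw [mul_comm]; exact h _ (isHomogeneous_X k j)
    have hpure : ∀ j, coeff (Finsupp.single j (d + 1)) f = 0 := fun j =>
      (powerForm_X_mul (d + 1) j f).symm.trans (congrArg Prod.fst (hX j))
    rintro (i | i)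
    · exact hpure i
    · have := (chainForm_X_mul d J i.1 f hpure).symm.trans (congrArg Prod.snd (hX i.1))
      rwa [if_pos i.2] at this
  · intro h g hg
    have hpure : ∀ j, coeff (Finsupp.single j (d + 1)) f = 0 := fun j => h (Sum.inl j)
    have hX : ∀ j, pencil k n (d + 1) J (f * X j) = 0 := fun j => by
      rw [mul_comm]
      refine Prod.ext ((powerForm_X_mul (d + 1) j f).trans (hpure j)) ?_
      refine (chainForm_X_mul d J j f hpure).trans ?_
      split_ifs with hj
      · exact h (Sum.inr ⟨j, hj⟩)
      · rfl
    have hg' : g ∈ Submodule.span k (Set.range (X : Fin (n + 2) → MvPolynomial _ k)) := by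
      rw [← homogeneousSubmodule_one_eq_span_X]; exact hg
    have hle : Submodule.span k (Set.range (X : Fin (n + 2) → MvPolynomial _ k)) ≤
        LinearMap.ker (pencil k n (d + 1) J ∘ₗ LinearMap.mulLeft k f) := by
      rw [Submodule.span_le]
      rintro _ ⟨j, rfl⟩
      exact hX j
    exact hle hg'

theorem hVector_apolarIdeal_pencil {d J : ℕ} (hJ : J ≤ n + 2) (h : ¬(n = 0 ∧ d = 0 ∧ J = 2)) :
    hVector (apolarIdeal (pencil k n (d + 2) J)) (d + 2) = n + 2 + J := by
  have hcard : Fintype.card {i : Fin (n + 2) // (i : ℕ) < J} = J := by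
    rw [Fintype.card_congr (Fin.castLEquiv hJ).symm]
    simp
  have := hVector_eq_finrank (I := apolarIdeal (pencil k n (d + 2) J)) (i := d + 2)
    (LinearMap.pi fun s => lcoeff k (exponents n (d + 1) J s)) (fun f hf => ?_) (fun w => ?_)
  · rw [this, Module.finrank_pi, Fintype.card_sum, Fintype.card_fin, hcard]
  · rw [mem_apolarIdeal_pencil_iff (d + 1) J hf, funext_iff]
    rfl
  · obtain ⟨f, hf, hw⟩ := exists_isHomogeneous_coeff_eq (exponents_injective hJ h)
      (degree_exponents n (d + 1) J) w
    exact ⟨f, hf, funext hw⟩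

theorem exists_isLevelHVector (k : Type*) [Field k] {d J : ℕ} (hJ : J ≤ n + 2)
    (h : ¬(n = 0 ∧ d = 0 ∧ J = 2)) :
    ∃ h : ℕ → ℕ, IsLevelHVector k (n + 2) (d + 3) 2 h ∧
      h 0 = 1 ∧ h 1 = n + 2 ∧ h (d + 2) = n + 2 + J ∧ h (d + 3) = 2 := by
  have hT : Module.finrank k (k × k) = 2 := by simp
  have hA := (isConcentrated_pencil (k := k) (n := n) (d + 2) J).isLevelAlgebra
    (surjective_pencil (by omega) J) (by omega) (eq_zero_of_mem_apolarIdeal_pencil (d + 1) J)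
  rw [hT] at hA
  refine ⟨_, ⟨_, hA, rfl⟩, hVector_zero fun htop => ?_, hA.hVector_one,
    hVector_apolarIdeal_pencil hJ h, hA.hVector_socleDegree⟩
  have h1 := hA.no_linear_form (X 0) (htop ▸ Submodule.mem_top) (isHomogeneous_X k 0)
  exact X_ne_zero 0 h1

end Construction

end LevelAlgebra

theorem theorem3p3 (k : Type*) [Field k] [CharZero k] (r : ℕ) :
    (∀ (e : ℕ) (h : ℕ → ℕ), 2 ≤ e → LevelAlgebra.IsLevelHVector k r e 2 h →
      h (e - 1) ≤ 2 * r) ∧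
    (∀ e a : ℕ, 2 ≤ r → 3 ≤ e → r ≤ a → a ≤ 2 * r → ¬(r = 2 ∧ e = 3 ∧ a = 4) →
      ∃ h : ℕ → ℕ, LevelAlgebra.IsLevelHVector k r e 2 h ∧
        h 0 = 1 ∧ h 1 = r ∧ h (e - 1) = a ∧ h e = 2) ∧
    (r ≤ 7 → ∀ (e : ℕ) (h : ℕ → ℕ), 2 ≤ e → LevelAlgebra.IsLevelHVector k r e 2 h →
      r ≤ h (e - 1)) := by
  refine ⟨?_, ?_, ?_⟩
  · rintro e _ he ⟨I, hI, rfl⟩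
    obtain ⟨e, rfl⟩ := Nat.exists_eq_add_of_le' he
    rw [mul_comm]
    exact hI.hVector_le
  · intro e a hr he ha ha' hne
    obtain ⟨n, rfl⟩ := Nat.exists_eq_add_of_le' hr
    obtain ⟨d, rfl⟩ := Nat.exists_eq_add_of_le' he
    obtain ⟨J, rfl⟩ := Nat.exists_eq_add_of_le ha
    exact LevelAlgebra.exists_isLevelHVector k (by omega) (by omega)
  · rintro hr e _ he ⟨I, hI, rfl⟩
    obtain ⟨e, rfl⟩ := Nat.exists_eq_add_of_le' he
    exact hI.le_hVector hr
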